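/- Let $\Omega\subset\mathbb R^2$ be open, $D\subset\Omega$ measurable, $T,\nu,\mu,\lambda_0>0$, $u_0\in L^2(\Omega)$, and let $\lambda=\lambda_0$ on $\Omega\setminus D$, $\lambda=0$ on $D$. Denote by $H^2_0(\Omega)$ the space of all $g\in H^2(\Omega)$ with $g=\nabla g\cdot\vec n=0$ on $\partial\Omega$, i.e. the closure of $C_c^\infty(\Omega)$ in $H^2(\Omega)$, and let $$W_2=\{\varphi\in L^2(0,T;H^2(\Omega)):\ \varphi(t)\in H^2_0(\Omega)\ \text{for a.e. } t\}$$ with the norm of $L^2(0,T;H^2(\Omega))$. Let $\mathcal M(\mathbb R)$ be the space of finite signed Borel measures on $\mathbb R$. A pair $(u,\pi)$ is called a solution of $$\partial_t u=\Delta\big(-\nu\arctan(\Delta u)|\nabla u|-\mu\Delta u\big)+\lambda(u_0-u)\ \text{ in }(0,T)\times\Omega,\qquad u|_{t=0}=u_0,\qquad u=\tfrac{\partial u}{\partial\vec n}=0\ \text{ on }\partial\Omega,$$ if $u\in L^2(0,T;H^2(\Omega))$, if $\pi\in L^1_w([0,T]\times\Omega;\mathcal M(\mathbb R))$ (that is,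 $(t,x)\mapsto\pi_{(t,x)}$ is weakly measurable and $\int_0^T\!\int_\Omega|\pi_{(t,x)}|(\mathbb R)\,dx\,dt<\infty$), if $\int_{\mathbb R}\arctan(\xi)\,d\pi_{(t,x)}(\xi)$ is in $L^\infty([0,T]\times\Omega)$, and if for every Lipschitz map $\varphi:[0,T]\to H^2(\Omega)$ with $\varphi(t)\in H^2_0(\Omega)$ for all $t$ and $\varphi(T)=0$ $$\int_0^T\!\!\int_\Omega u\,\partial_t\varphi\,dx\,dt+\int_\Omega u_0\,\varphi(0)\,dx=\int_0^T\!\!\int_\Omega\Big(\nu\int_{\mathbb R}\arctan(\xi)\,d\pi_{(t,x)}(\xi)\,|\nabla u|+\mu\Delta u\Big)\Delta\varphi\,dx\,dt-\int_0^T\!\!\int_\Omega\lambda(u_0-u)\varphi\,dx\,dt .$$ Let $(u,\pi)$ be a solution. Then there is a constant $c$ such that for every smooth, compactly supported $\rho:\mathbb R\to[0,\infty)$ with $\int_{\mathbb R}\rho=1$ and every $\varepsilon>0$ the following holds. (i) Let $u^\varepsilon(t,\cdot)=\int_0^T\frac1\varepsilon\,\rho\big(\frac{t-\tau}{\varepsilon}\big)\,u(\tau,\cdot)\,d\tau$,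 and let $I_\varepsilon$ be the set of those $t\in[0,T]$ for which $\tau\mapsto\rho\big(\frac{t-\tau}\varepsilon\big)$ vanishes outside $[0,T]$ (the times at which the mollification uses only values of $u$ on $[0,T]$). Then $u^\varepsilon:\mathbb R\to L^2(\Omega)$ is differentiable and, for every $\varphi\in W_2$, the function $t\mapsto\int_\Omega\partial_tu^\varepsilon\,\varphi\,dx$ is integrable on $I_\varepsilon$ and $$\Big|\int_{I_\varepsilon}\int_\Omega\partial_tu^\varepsilon\,\varphi\,dx\,dt\Big|\le c\,\|\varphi\|_{W_2}.$$ (ii) Suppose that $\varepsilon|z|\le T$ whenever $\rho(z)\ne0$. Extend $u$ from $[0,T]$ to $[-T,2T]$ by even reflection at $t=0$ and $t=T$, and let $u^\varepsilon(t,\cdot)=\int_{-T}^{2T}\frac1\varepsilon\,\rho\big(\frac{t-\tau}{\varepsilon}\big)\,u(\tau,\cdot)\,d\tau$. Then $u^\varepsilon:\mathbb R\to L^2(\Omega)$ is differentiable and, for every $\varphi\in W_2$, the function $t\mapsto\int_\Omega\partial_tu^\varepsilon\,\varphi\,dx$ is integrable on $[0,T]$ and $$|\langle\partial_tu^\varepsilon,\varphi\rangle|=\Big|\int_0^T\!\!\int_\Omega\partial_tu^\varepsilon\,\varphi\,dx\,dt\Big|\le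 c\,\|\varphi\|_{W_2}.$$ -/

import Mathlib

open MeasureTheory Set
open scoped ContDiff BoundedContinuousFunction

namespace ShockFilter

/-- The Euclidean plane. -/
abbrev Plane := EuclideanSpace ℝ (Fin 2)

/-- `L²(Ω)`. -/
noncomputable abbrev L2 (Ω : Set Plane) := Lp ℝ 2 (volume.restrict Ω)

/-- `L²(Ω; ℝ²)`. -/
noncomputable abbrev L2Vec (Ω : Set Plane) := Lp (EuclideanSpace ℝ (Fin 2)) 2 (volume.restrict Ω)

/-- `L²(Ω; ℝ^{2 × 2})`, with the Frobenius norm on matrices. -/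
noncomputable abbrev L2Mat (Ω : Set Plane) := Lp (EuclideanSpace ℝ (Fin 2 × Fin 2)) 2 (volume.restrict Ω)

/-- Triples of a function, a vector field and a matrix field on `Ω`, with the Hilbert norm
`(‖f‖² + ‖g‖² + ‖h‖²)^{1/2}`. -/
noncomputable abbrev L2Jet (Ω : Set Plane) := WithLp 2 (L2 Ω × WithLp 2 (L2Vec Ω × L2Mat Ω))

/-- Smooth functions with compact support in `Ω`. -/
def IsTestFunction (Ω : Set Plane) (θ : Plane → ℝ) : Prop :=
  ContDiff ℝ ∞ θ ∧ HasCompactSupport θ ∧ tsupport θ ⊆ Ω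

/-- `g` is the weak partial derivative `∂ᵢ f` on `Ω`. -/
def HasWeakPartial (Ω : Set Plane) (i : Fin 2) (f g : Plane → ℝ) : Prop :=
  ∀ θ : Plane → ℝ, IsTestFunction Ω θ →
    ∫ x in Ω, f x * fderiv ℝ θ x (EuclideanSpace.single i 1) = -∫ x in Ω, g x * θ x

/-- The triple is a function together with its weak gradient and its weak Hessian. -/
def IsWeakJet (Ω : Set Plane) (w : L2Jet Ω) : Prop :=
  (∀ i, HasWeakPartial Ω i (w.fst : Plane → ℝ) (fun x => (w.snd.fst : Plane → _) x i)) ∧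
  ∀ i j, HasWeakPartial Ω j (fun x => (w.snd.fst : Plane → _) x i)
    (fun x => (w.snd.snd : Plane → _) x (i, j))

lemma IsTestFunction.memLp {Ω : Set Plane} {θ : Plane → ℝ} (h : IsTestFunction Ω θ) :
    MemLp θ 2 (volume.restrict Ω) :=
  (h.1.continuous.memLp_of_hasCompactSupport h.2.1).restrict Ω

lemma IsTestFunction.memLp_fderiv {Ω : Set Plane} {θ : Plane → ℝ} (h : IsTestFunction Ω θ)
    (v : Plane) : MemLp (fun x => fderiv ℝ θ x v) 2 (volume.restrict Ω) := by
  refine (Continuous.memLp_of_hasCompactSupport ?_ ?_).restrict Ω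
  · exact (h.1.continuous_fderiv (by simp)).clm_apply continuous_const
  · exact h.2.1.fderiv_apply (𝕜 := ℝ) v

lemma HasWeakPartial.congr {Ω : Set Plane} {i : Fin 2} {f f' g g' : Plane → ℝ}
    (h : HasWeakPartial Ω i f g) (hf : f' =ᵐ[volume.restrict Ω] f)
    (hg : g' =ᵐ[volume.restrict Ω] g) : HasWeakPartial Ω i f' g' := by
  intro θ hθ
  have e₁ : ∫ x in Ω, f' x * fderiv ℝ θ x (EuclideanSpace.single i 1) =
      ∫ x in Ω, f x * fderiv ℝ θ x (EuclideanSpace.single i 1) := by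
    refine integral_congr_ae ?_
    filter_upwards [hf] with x hx
    rw [hx]
  have e₂ : ∫ x in Ω, g' x * θ x = ∫ x in Ω, g x * θ x := by
    refine integral_congr_ae ?_
    filter_upwards [hg] with x hx
    rw [hx]
  rw [e₁, e₂]
  exact h θ hθ

lemma HasWeakPartial.add {Ω : Set Plane} {i : Fin 2} {f f' g g' : Plane → ℝ}
    (h : HasWeakPartial Ω i f g) (h' : HasWeakPartial Ω i f' g')
    (hf : MemLp f 2 (volume.restrict Ω)) (hf' : MemLp f' 2 (volume.restrict Ω))
    (hg : MemLp g 2 (volume.restrict Ω)) (hg' : MemLp g' 2 (volume.restrict Ω)) :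
    HasWeakPartial Ω i (fun x => f x + f' x) (fun x => g x + g' x) := by
  intro θ hθ
  have a := hθ.memLp_fderiv (EuclideanSpace.single i 1)
  have b := hθ.memLp
  have e₁ := integral_add (hf.integrable_mul a) (hf'.integrable_mul a)
  have e₂ := integral_add (hg.integrable_mul b) (hg'.integrable_mul b)
  have h₁ := h θ hθ
  have h₂ := h' θ hθ
  simp only [Pi.mul_apply] at e₁ e₂
  simp only [add_mul]
  rw [e₁, e₂, h₁, h₂]
  ring

lemma HasWeakPartial.smul {Ω : Set Plane} {i : Fin 2} {f g : Plane → ℝ}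
    (h : HasWeakPartial Ω i f g) (c : ℝ) :
    HasWeakPartial Ω i (fun x => c * f x) (fun x => c * g x) := by
  intro θ hθ
  simp only [mul_assoc, integral_const_mul, h θ hθ]
  ring

lemma memLp_coord {ι : Type*} [Fintype ι] {Ω : Set Plane}
    (f : Lp (EuclideanSpace ℝ ι) 2 (volume.restrict Ω)) (i : ι) :
    MemLp (fun x => (f : Plane → EuclideanSpace ℝ ι) x i) 2 (volume.restrict Ω) :=
  (EuclideanSpace.proj i : EuclideanSpace ℝ ι →L[ℝ] ℝ).comp_memLp' (Lp.memLp f)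

/-- The Sobolev space `H²(Ω)`: functions in `L²(Ω)` with weak first and second derivatives in
`L²(Ω)`, normed by `(‖f‖² + ‖∇f‖² + ‖D²f‖²)^{1/2}`. An element carries its (unique) weak gradient
and Hessian. -/
def H2Submodule (Ω : Set Plane) : Submodule ℝ (L2Jet Ω) where
  carrier := {w | IsWeakJet Ω w}
  zero_mem' := by
    refine ⟨fun i => ?_, fun i j => ?_⟩
    · have h : HasWeakPartial Ω i (fun _ => 0) (fun _ => 0) := fun θ _ => by simp
      refine h.congr (Lp.coeFn_zero ℝ 2 _) ?_
      filter_upwards [Lp.coeFn_zero (EuclideanSpace ℝ (Fin 2)) 2 (volume.restrict Ω)] with x hx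
      simpa using congrArg (fun v => v i) hx
    · have h : HasWeakPartial Ω j (fun _ => 0) (fun _ => 0) := fun θ _ => by simp
      refine h.congr ?_ ?_
      · filter_upwards [Lp.coeFn_zero (EuclideanSpace ℝ (Fin 2)) 2 (volume.restrict Ω)] with x hx
        simpa using congrArg (fun v => v i) hx
      · filter_upwards [Lp.coeFn_zero (EuclideanSpace ℝ (Fin 2 × Fin 2)) 2 (volume.restrict Ω)]
          with x hx
        simpa using congrArg (fun v => v (i, j)) hx
  add_mem' := by
    intro v w hv hw
    refine ⟨fun i => ?_, fun i j => ?_⟩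
    · refine ((hv.1 i).add (hw.1 i) (Lp.memLp _) (Lp.memLp _) (memLp_coord _ i)
        (memLp_coord _ i)).congr (Lp.coeFn_add _ _) ?_
      filter_upwards [Lp.coeFn_add v.snd.fst w.snd.fst] with x hx
      simpa using congrArg (fun v => v i) hx
    · refine ((hv.2 i j).add (hw.2 i j) (memLp_coord _ i) (memLp_coord _ i) (memLp_coord _ (i, j))
        (memLp_coord _ (i, j))).congr ?_ ?_
      · filter_upwards [Lp.coeFn_add v.snd.fst w.snd.fst] with x hx
        simpa using congrArg (fun v => v i) hx
      · filter_upwards [Lp.coeFn_add v.snd.snd w.snd.snd] with x hx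
        simpa using congrArg (fun v => v (i, j)) hx
  smul_mem' := by
    intro c w hw
    refine ⟨fun i => ?_, fun i j => ?_⟩
    · refine ((hw.1 i).smul c).congr (Lp.coeFn_smul _ _) ?_
      filter_upwards [Lp.coeFn_smul c w.snd.fst] with x hx
      simpa using congrArg (fun v => v i) hx
    · refine ((hw.2 i j).smul c).congr ?_ ?_
      · filter_upwards [Lp.coeFn_smul c w.snd.fst] with x hx
        simpa using congrArg (fun v => v i) hx
      · filter_upwards [Lp.coeFn_smul c w.snd.snd] with x hx
        simpa using congrArg (fun v => v (i, j)) hx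

/-- The Sobolev space `H²(Ω)`, as a type. -/
abbrev H2 (Ω : Set Plane) := ↥(H2Submodule Ω)

/-- The function underlying an element of `H²(Ω)`. -/
def H2.fn {Ω : Set Plane} (w : H2 Ω) : L2 Ω := (w : L2Jet Ω).fst

/-- The gradient of an element of `H²(Ω)`. -/
def H2.grad {Ω : Set Plane} (w : H2 Ω) : L2Vec Ω := (w : L2Jet Ω).snd.fst

/-- The Laplacian `∂₁₁ w + ∂₂₂ w` of an element of `H²(Ω)`. -/
noncomputable def H2.lap {Ω : Set Plane} (w : H2 Ω) (x : Plane) : ℝ :=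
  ((w : L2Jet Ω).snd.snd : Plane → EuclideanSpace ℝ (Fin 2 × Fin 2)) x (0, 0) +
    ((w : L2Jet Ω).snd.snd : Plane → EuclideanSpace ℝ (Fin 2 × Fin 2)) x (1, 1)

/-- `H²₀(Ω)`, the functions in `H²(Ω)` with `w = ∂w/∂n = 0` on `∂Ω`: the closure of the test
functions in `H²(Ω)`. -/
def H20 (Ω : Set Plane) : Set (H2 Ω) :=
  closure {w | ∃ θ : Plane → ℝ, IsTestFunction Ω θ ∧ (w.fn : Plane → ℝ) =ᵐ[volume.restrict Ω] θ}

/-- `L²(0,T; H²(Ω))`. -/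
def MemL2H2 (Ω : Set Plane) (T : ℝ) (u : ℝ → H2 Ω) : Prop :=
  MemLp u 2 (volume.restrict (Icc 0 T))

/-- The norm of `L²(0,T; H²(Ω))`. -/
noncomputable def normL2H2 (Ω : Set Plane) (T : ℝ) (u : ℝ → H2 Ω) : ℝ :=
  (eLpNorm u 2 (volume.restrict (Icc 0 T))).toReal

/-- The space `W₂` of the `φ ∈ L²(0,T; H²(Ω))` with `φ = ∂φ/∂n = 0` on `[0,T] × ∂Ω`. -/
def MemW2 (Ω : Set Plane) (T : ℝ) (φ : ℝ → H2 Ω) : Prop :=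
  MemL2H2 Ω T φ ∧ ∀ᵐ t ∂volume.restrict (Icc 0 T), φ t ∈ H20 Ω

/-- `L¹_w([0,T] × Ω; 𝓜(ℝ))`: weakly measurable maps into the finite signed measures on `ℝ` whose
total variation norm is integrable. -/
def MemL1w (Ω : Set Plane) (T : ℝ) (π : ℝ → Plane → SignedMeasure ℝ) : Prop :=
  (∀ g : ℝ →ᵇ ℝ, AEMeasurable (fun z : ℝ × Plane => ∫ᵛ ξ, g ξ ∂<•(π z.1 z.2))
    (volume.restrict (Icc 0 T ×ˢ Ω))) ∧
  ∫⁻ z in Icc 0 T ×ˢ Ω, (π z.1 z.2).totalVariation univ < ⊤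

/-- The mean `∫ arctan(ξ) dπ_{(t,x)}(ξ)`. -/
noncomputable def arctanMean (π : ℝ → Plane → SignedMeasure ℝ) (t : ℝ) (x : Plane) : ℝ :=
  ∫ᵛ ξ, Real.arctan ξ ∂<•(π t x)

/-- The fidelity coefficient: `lam0` on `Ω \ D` and `0` on the inpainting domain `D`. -/
noncomputable def fidelity (Ω D : Set Plane) (lam0 : ℝ) : Plane → ℝ :=
  (Ω \ D).indicator fun _ => lam0

/-- Admissible test functions of the weak formulation: Lipschitz maps `[0,T] → H²(Ω)` with
`φ = ∂φ/∂n = 0` on the boundary and `φ(T, ·) = 0`. -/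
def IsSolTest (Ω : Set Plane) (T : ℝ) (φ : ℝ → H2 Ω) : Prop :=
  (∃ K, LipschitzOnWith K φ (Icc 0 T)) ∧ (∀ t ∈ Icc 0 T, φ t ∈ H20 Ω) ∧ φ T = 0

/-- The pair `(u, π)` is a (Young measure) solution of
`∂ₜu = Δ(-ν arctan(Δu)|∇u| - μ Δu) + λ (u₀ - u)` on `(0,T) × Ω`, with `u = u₀` at `t = 0` and
`u = ∂u/∂n = 0` on the boundary. -/
structure IsYoungSolution (Ω D : Set Plane) (T ν μ lam0 : ℝ) (u0 : L2 Ω) (u : ℝ → H2 Ω)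
    (π : ℝ → Plane → SignedMeasure ℝ) : Prop where
  memL2H2 : MemL2H2 Ω T u
  memL1w : MemL1w Ω T π
  weak_form : ∀ φ : ℝ → H2 Ω, IsSolTest Ω T φ →
    (∫ t in Icc 0 T, ∫ x in Ω, (u t).fn x * (deriv φ t).fn x) + ∫ x in Ω, u0 x * (φ 0).fn x =
      (∫ t in Icc 0 T, ∫ x in Ω,
        (ν * arctanMean π t x * ‖(u t).grad x‖ + μ * (u t).lap x) * (φ t).lap x) -
      ∫ t in Icc 0 T, ∫ x in Ω, fidelity Ω D lam0 x * (u0 x - (u t).fn x) * (φ t).fn x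
  bounded_mean : ∃ C : ℝ, ∀ᵐ z ∂(volume : Measure (ℝ × Plane)).restrict (Icc 0 T ×ˢ Ω),
    |arctanMean π z.1 z.2| ≤ C

/-- A smooth, compactly supported, nonnegative kernel on `ℝ` of integral one. -/
structure IsMollifier (ρ : ℝ → ℝ) : Prop where
  smooth : ContDiff ℝ ∞ ρ
  compactSupport : HasCompactSupport ρ
  nonneg : ∀ z, 0 ≤ ρ z
  integral_eq_one : ∫ z, ρ z = 1

/-- The convolution in time, with the kernel `ε⁻¹ ρ(·/ε)`, of a function given on the time set
`J`. -/
noncomputable def timeMollify {Ω : Set Plane} (ρ : ℝ → ℝ) (ε : ℝ) (J : Set ℝ) (u : ℝ → H2 Ω)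
    (t : ℝ) : L2 Ω :=
  ∫ τ in J, (ε⁻¹ * ρ ((t - τ) / ε)) • (u τ).fn

/-- The times `t ∈ [0,T]` at which the kernel `ε⁻¹ ρ((t - ·)/ε)` lives on `[0,T]`. -/
def mollifyDomain (ρ : ℝ → ℝ) (ε T : ℝ) : Set ℝ :=
  {t ∈ Icc 0 T | ∀ τ, ρ ((t - τ) / ε) ≠ 0 → τ ∈ Icc 0 T}

/-- The extension of `u` from `[0,T]` to `[-T,2T]` by even reflection in the two end points. -/
noncomputable def reflect {Ω : Set Plane} (T : ℝ) (u : ℝ → H2 Ω) (t : ℝ) : H2 Ω :=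
  if t < 0 then u (-t) else if t ≤ T then u t else u (2 * T - t)

/-- On the time set `I`, `∂ₜv` is a functional on `W₂` of norm at most `c`. -/
def TimeDerivBounded (Ω : Set Plane) (T : ℝ) (I : Set ℝ) (v : ℝ → L2 Ω) (c : ℝ) : Prop :=
  Differentiable ℝ v ∧ ∀ φ : ℝ → H2 Ω, MemW2 Ω T φ →
    IntegrableOn (fun t => ∫ x in Ω, deriv v t x * (φ t).fn x) I ∧
    |∫ t in I, ∫ x in Ω, deriv v t x * (φ t).fn x| ≤ c * normL2H2 Ω T φ

end ShockFilter

namespace ShockFilter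

/-! The estimate is a duality argument: move the mollification from `u` to the test function. For a
`C¹` kernel `k(s,t)` put `ψ(s) = ∫_I k(s,t) φ(t) dt`. If `k(T,t) = 0` for `t ∈ I`, then `ψ` is
Lipschitz in time with values in `H²₀` and vanishes at `T`, so it is admissible in the weak
formulation; if also `k(0,t) = 0`, the initial term drops out. What remains on the left is the
pairing of `u` with `∫_I ∂ₛk(s,t) φ(t) dt`. By Fubini (`IsC1Kernel.integral_inner_swap`) this is the
pairing of `φ` with `∫ ∂ₛk(s,t) u(s) ds`, which is `-∂ₜu^ε(t)` for the right `k`.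

The right side costs no time derivative: the arctan mean is bounded, so it is at most `∫ (A‖u‖ +
B)‖ψ‖` (`IsYoungSolution.exists_enorm_rhs_le`). Schur's test bounds this by the row and column
masses of `|k|` times `‖A‖u‖ + B‖ ‖φ‖` in `L²(0,T)`. Mollifiers have mass one at every scale, hence
a constant independent of `ρ` and `ε`; all this is `IsYoungSolution.exists_kernel_bound`.

With `r = ε⁻¹ρ(·/ε)`, part (i) uses `k = r(t-s)`. In part (ii), folding the reflected integral onto
`[0,T]` leads to `k = r(t-s) - r(t+s) - r(t+s-2T)`. The image terms carry the opposite sign because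
`∂ₜ` and `∂ₛ` agree on functions of `t+s` and are opposite on functions of `t-s`. The same signs
make `k` vanish at both end points. -/

/-! ### `H²(Ω)` as a Hilbert space and `H²₀(Ω)` as a closed subspace -/

/-- Evaluation `w ↦ w` of an element of `H²(Ω)` in `L²(Ω)`, as a continuous linear map. -/
noncomputable def H2.fnL (Ω : Set Plane) : H2 Ω →L[ℝ] L2 Ω :=
  (WithLp.fstL 2 ℝ (L2 Ω) (WithLp 2 (L2Vec Ω × L2Mat Ω))).comp (H2Submodule Ω).subtypeL

lemma H2.norm_fn_le {Ω : Set Plane} (w : H2 Ω) : ‖w.fn‖ ≤ ‖w‖ :=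
  WithLp.norm_fst_le _ (w : L2Jet Ω)

lemma H2.norm_grad_le {Ω : Set Plane} (w : H2 Ω) : ‖w.grad‖ ≤ ‖w‖ :=
  (WithLp.norm_fst_le _ (w : L2Jet Ω).snd).trans
    (WithLp.norm_snd_le _ (w : L2Jet Ω))

lemma H2.norm_hess_le {Ω : Set Plane} (w : H2 Ω) : ‖(w : L2Jet Ω).snd.snd‖ ≤ ‖w‖ :=
  (WithLp.norm_snd_le _ (w : L2Jet Ω).snd).trans
    (WithLp.norm_snd_le _ (w : L2Jet Ω))

lemma H2.abs_lap_le {Ω : Set Plane} (w : H2 Ω) (x : Plane) :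
    |w.lap x| ≤ 2 * ‖((w : L2Jet Ω).snd.snd : Plane → EuclideanSpace ℝ (Fin 2 × Fin 2)) x‖ := by
  have h := fun i => PiLp.norm_apply_le
    (((w : L2Jet Ω).snd.snd : Plane → EuclideanSpace ℝ (Fin 2 × Fin 2)) x) i
  have h0 := h (0, 0)
  have h1 := h (1, 1)
  rw [Real.norm_eq_abs] at h0 h1
  exact (abs_add_le _ _).trans (by linarith)

/-- A coordinate of a square integrable vector field. -/
noncomputable def coordL {ι : Type*} [Fintype ι] (Ω : Set Plane) (i : ι) :
    Lp (EuclideanSpace ℝ ι) 2 (volume.restrict Ω) →L[ℝ] L2 Ω :=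
  (EuclideanSpace.proj i : EuclideanSpace ℝ ι →L[ℝ] ℝ).compLpL 2 (volume.restrict Ω)

lemma coordL_ae {ι : Type*} [Fintype ι] {Ω : Set Plane} (i : ι)
    (f : Lp (EuclideanSpace ℝ ι) 2 (volume.restrict Ω)) :
    (coordL Ω i f : Plane → ℝ) =ᵐ[volume.restrict Ω] fun x => (f : Plane → _) x i :=
  ContinuousLinearMap.coeFn_compLpL _ f

lemma inner_toLp_eq {Ω : Set Plane} (f : L2 Ω) {g h : Plane → ℝ}
    (hg : MemLp g 2 (volume.restrict Ω)) (hf : (f : Plane → ℝ) =ᵐ[volume.restrict Ω] h) :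
    inner ℝ f (hg.toLp g) = ∫ x in Ω, h x * g x := by
  rw [L2.inner_def]
  refine integral_congr_ae ?_
  filter_upwards [hg.coeFn_toLp, hf] with x hx hx'
  rw [hx, hx', real_inner_eq_re_inner]
  simp [mul_comm]

lemma inner_eq_integral {Ω : Set Plane} (f g : L2 Ω) :
    inner ℝ f g = ∫ x in Ω, f x * g x := by
  rw [L2.inner_def]
  refine integral_congr_ae (Filter.Eventually.of_forall fun x => ?_)
  simp [mul_comm]

/-- For each fixed test function the defining identity equates two `L²` pairings, both continuous in
`F` and `G`. The representatives `f`, `g` are kept apart from `F`, `G` because a coordinate of a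
vector-valued class is only a.e. equal to its `coordL`. -/
lemma isClosed_hasWeakPartial {Ω : Set Plane} {X : Type*} [TopologicalSpace X] (i : Fin 2)
    {f g : X → Plane → ℝ} {F G : X → L2 Ω} (hF : Continuous F) (hG : Continuous G)
    (hf : ∀ w, (F w : Plane → ℝ) =ᵐ[volume.restrict Ω] f w)
    (hg : ∀ w, (G w : Plane → ℝ) =ᵐ[volume.restrict Ω] g w) :
    IsClosed {w | HasWeakPartial Ω i (f w) (g w)} := by
  simp only [HasWeakPartial, ofPred_forall]
  refine isClosed_iInter fun θ => isClosed_iInter fun hθ => ?_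
  have e : {w | ∫ x in Ω, f w x * fderiv ℝ θ x (EuclideanSpace.single i 1) =
      -∫ x in Ω, g w x * θ x} = {w | inner ℝ (F w) ((hθ.memLp_fderiv _).toLp
        (fun x => fderiv ℝ θ x (EuclideanSpace.single i 1))) = -inner ℝ (G w) (hθ.memLp.toLp θ)} := by
    ext w
    simp only [mem_ofPred_eq]
    rw [inner_toLp_eq _ _ (hf w), inner_toLp_eq _ _ (hg w)]
  rw [e]
  exact isClosed_eq (hF.inner continuous_const) (hG.inner continuous_const).neg

lemma isClosed_H2Submodule (Ω : Set Plane) : IsClosed (H2Submodule Ω : Set (L2Jet Ω)) := by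
  have e : (H2Submodule Ω : Set (L2Jet Ω)) =
      (⋂ i, {w : L2Jet Ω | HasWeakPartial Ω i (w.fst : Plane → ℝ)
        (fun x => (w.snd.fst : Plane → _) x i)}) ∩
      ⋂ i, ⋂ j, {w : L2Jet Ω | HasWeakPartial Ω j (fun x => (w.snd.fst : Plane → _) x i)
        (fun x => (w.snd.snd : Plane → _) x (i, j))} := by
    ext w
    simp only [mem_inter_iff, mem_iInter, mem_ofPred_eq]
    rfl
  have c1 : Continuous fun w : L2Jet Ω => w.fst := WithLp.continuous_fst 2 _ _
  have c2 : Continuous fun w : L2Jet Ω => w.snd.fst :=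
    (WithLp.continuous_fst 2 _ _).comp (WithLp.continuous_snd 2 _ _)
  have c3 : Continuous fun w : L2Jet Ω => w.snd.snd :=
    (WithLp.continuous_snd 2 _ _).comp (WithLp.continuous_snd 2 _ _)
  rw [e]
  refine (isClosed_iInter fun i => ?_).inter (isClosed_iInter fun i => isClosed_iInter fun j => ?_)
  · exact isClosed_hasWeakPartial i c1 ((coordL Ω i).continuous.comp c2)
      (fun w => Filter.EventuallyEq.rfl) (fun w => coordL_ae i _)
  · exact isClosed_hasWeakPartial j ((coordL Ω i).continuous.comp c2)
      ((coordL Ω (i, j)).continuous.comp c3) (fun w => coordL_ae i _) (fun w => coordL_ae (i, j) _)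

/-- Needed for Bochner integrals in `H²(Ω)` and for the orthogonal projection onto `H²₀(Ω)`. -/
instance (Ω : Set Plane) : CompleteSpace (H2 Ω) :=
  (isClosed_H2Submodule Ω).completeSpace_coe

/-- `H²₀(Ω)` as a closed subspace of `H²(Ω)`. -/
noncomputable def H20Submodule (Ω : Set Plane) : Submodule ℝ (H2 Ω) :=
  Submodule.topologicalClosure
    { carrier := {w | ∃ θ : Plane → ℝ, IsTestFunction Ω θ ∧
        (w.fn : Plane → ℝ) =ᵐ[volume.restrict Ω] θ}
      zero_mem' := by
        refine ⟨0, ⟨contDiff_const, HasCompactSupport.zero, by simp⟩, ?_⟩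
        exact Lp.coeFn_zero ℝ 2 (volume.restrict Ω)
      add_mem' := by
        rintro v w ⟨θ, hθ, hv⟩ ⟨η, hη, hw⟩
        refine ⟨θ + η, ⟨hθ.1.add hη.1, hθ.2.1.add hη.2.1,
          (tsupport_add θ η).trans (union_subset hθ.2.2 hη.2.2)⟩, ?_⟩
        exact (Lp.coeFn_add v.fn w.fn).trans (hv.add hw)
      smul_mem' := by
        rintro c w ⟨θ, hθ, hw⟩
        refine ⟨c • θ, ⟨hθ.1.const_smul c, hθ.2.1.smul_left (f := fun _ => c),
          (tsupport_smul_subset_right (fun _ => c) θ).trans hθ.2.2⟩, ?_⟩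
        exact (Lp.coeFn_smul c w.fn).trans (hw.const_smul c) }

lemma isClosed_H20Submodule (Ω : Set Plane) : IsClosed (H20Submodule Ω : Set (H2 Ω)) :=
  isClosed_closure

/-! ### Bounds for the right hand side of the weak formulation -/

lemma lintegral_norm_mul_norm_le {α E F : Type*} [MeasurableSpace α] {m : Measure α}
    [NormedAddCommGroup E] [NormedAddCommGroup F] (f : Lp E 2 m) (g : Lp F 2 m) :
    ∫⁻ x, ‖f x‖ₑ * ‖g x‖ₑ ∂m ≤ ‖f‖ₑ * ‖g‖ₑ := by
  have h := ENNReal.lintegral_mul_le_Lp_mul_Lq m Real.HolderConjugate.two_two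
    (Lp.aestronglyMeasurable f).enorm (Lp.aestronglyMeasurable g).enorm
  refine h.trans (le_of_eq ?_)
  rw [Lp.enorm_def, Lp.enorm_def, eLpNorm_eq_lintegral_rpow_enorm_toReal (by simp) (by simp),
    eLpNorm_eq_lintegral_rpow_enorm_toReal (by simp) (by simp)]
  simp

/-- Cauchy–Schwarz in `x`. Each Laplacian is at most twice the Frobenius norm of the Hessian: one
factor 2 appears with `ν`, two with `μ`. -/
lemma enorm_integral_diffusion_le {Ω : Set Plane} (ν μ : ℝ) {C : ℝ} {a : Plane → ℝ}
    (ha : ∀ᵐ x ∂volume.restrict Ω, |a x| ≤ C) (v w : H2 Ω) :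
    ‖∫ x in Ω, (ν * a x * ‖v.grad x‖ + μ * v.lap x) * w.lap x‖ₑ ≤
      ENNReal.ofReal (2 * |ν| * |C| + 4 * |μ|) * ‖v‖ₑ * ‖w‖ₑ := by
  set V := (v : L2Jet Ω).snd.snd
  set W := (w : L2Jet Ω).snd.snd
  have hb : ∀ᵐ x ∂volume.restrict Ω, ‖(ν * a x * ‖v.grad x‖ + μ * v.lap x) * w.lap x‖ₑ ≤
      ENNReal.ofReal (2 * |ν| * |C|) * (‖v.grad x‖ₑ * ‖W x‖ₑ) +
        ENNReal.ofReal (4 * |μ|) * (‖V x‖ₑ * ‖W x‖ₑ) := by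
    filter_upwards [ha] with x hx
    have h1 := v.abs_lap_le x
    have h2 := w.abs_lap_le x
    simp only [← ofReal_norm]
    rw [← ENNReal.ofReal_mul (norm_nonneg _), ← ENNReal.ofReal_mul (norm_nonneg _),
      ← ENNReal.ofReal_mul (by positivity), ← ENNReal.ofReal_mul (by positivity),
      ← ENNReal.ofReal_add (by positivity) (by positivity)]
    refine ENNReal.ofReal_le_ofReal ?_
    rw [norm_mul, Real.norm_eq_abs, Real.norm_eq_abs]
    have h3 : |ν * a x * ‖v.grad x‖ + μ * v.lap x| ≤
        |ν| * |C| * ‖v.grad x‖ + |μ| * (2 * ‖V x‖) := by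
      refine (abs_add_le _ _).trans ?_
      rw [abs_mul, abs_mul, abs_mul, abs_norm]
      have := hx.trans (le_abs_self C)
      gcongr
    calc _ ≤ (|ν| * |C| * ‖v.grad x‖ + |μ| * (2 * ‖V x‖)) * (2 * ‖W x‖) := by gcongr
      _ = _ := by ring
  refine (enorm_integral_le_lintegral_enorm _).trans ((lintegral_mono_ae hb).trans ?_)
  rw [lintegral_add_left', lintegral_const_mul' _ _ ENNReal.ofReal_ne_top,
    lintegral_const_mul' _ _ ENNReal.ofReal_ne_top]
  · rw [ENNReal.ofReal_add (by positivity) (by positivity), add_mul, add_mul, mul_assoc (ENNReal.ofReal _),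
      mul_assoc (ENNReal.ofReal _)]
    have e1 : ‖v.grad‖ₑ ≤ ‖v‖ₑ := enorm_le_iff_norm_le.2 v.norm_grad_le
    have e2 : ‖V‖ₑ ≤ ‖v‖ₑ := enorm_le_iff_norm_le.2 v.norm_hess_le
    have e3 : ‖W‖ₑ ≤ ‖w‖ₑ := enorm_le_iff_norm_le.2 w.norm_hess_le
    refine add_le_add (mul_le_mul_right ((lintegral_norm_mul_norm_le _ _).trans ?_) _)
      (mul_le_mul_right ((lintegral_norm_mul_norm_le _ _).trans ?_) _)
    · exact mul_le_mul' e1 e3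
    · exact mul_le_mul' e2 e3
  · exact ((Lp.aestronglyMeasurable _).enorm.mul (Lp.aestronglyMeasurable _).enorm).const_mul _

lemma enorm_integral_fidelity_le {Ω D : Set Plane} (lam0 : ℝ) (u0 v w : L2 Ω) :
    ‖∫ x in Ω, fidelity Ω D lam0 x * (u0 x - v x) * w x‖ₑ ≤
      ENNReal.ofReal |lam0| * (‖u0‖ₑ + ‖v‖ₑ) * ‖w‖ₑ := by
  have hb : ∀ᵐ x ∂volume.restrict Ω, ‖fidelity Ω D lam0 x * (u0 x - v x) * w x‖ₑ ≤
      ENNReal.ofReal |lam0| * (‖(u0 - v : L2 Ω) x‖ₑ * ‖w x‖ₑ) := by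
    filter_upwards [Lp.coeFn_sub u0 v] with x hx
    rw [hx, enorm_mul, enorm_mul, mul_assoc, Pi.sub_apply]
    gcongr
    rw [← ofReal_norm]
    refine ENNReal.ofReal_le_ofReal ?_
    exact norm_indicator_le_norm_self _ _
  refine (enorm_integral_le_lintegral_enorm _).trans ((lintegral_mono_ae hb).trans ?_)
  rw [lintegral_const_mul' _ _ ENNReal.ofReal_ne_top, mul_assoc]
  gcongr
  exact (lintegral_norm_mul_norm_le _ _).trans (mul_le_mul_left (enorm_sub_le ) _)

/-- The right hand side of the weak formulation is controlled by a weighted norm of the test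
function. -/
lemma IsYoungSolution.exists_enorm_rhs_le {Ω D : Set Plane} {T ν μ lam0 : ℝ} {u0 : L2 Ω}
    {u : ℝ → H2 Ω} {π : ℝ → Plane → SignedMeasure ℝ}
    (hu : IsYoungSolution Ω D T ν μ lam0 u0 u π) :
    ∃ A B : NNReal, ∀ φ : ℝ → H2 Ω, AEStronglyMeasurable φ (volume.restrict (Icc 0 T)) →
      ‖(∫ t in Icc 0 T, ∫ x in Ω,
        (ν * arctanMean π t x * ‖(u t).grad x‖ + μ * (u t).lap x) * (φ t).lap x) -
      ∫ t in Icc 0 T, ∫ x in Ω, fidelity Ω D lam0 x * (u0 x - (u t).fn x) * (φ t).fn x‖ₑ ≤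
      ∫⁻ t in Icc 0 T, (A * ‖u t‖ₑ + B) * ‖φ t‖ₑ := by
  obtain ⟨C, hC⟩ := hu.bounded_mean
  -- `A` collects the diffusion constant and the part of the fidelity term linear in `u`; `B` comes
  -- from `u0`.
  refine ⟨Real.toNNReal (2 * |ν| * |C| + 4 * |μ|) + Real.toNNReal |lam0|,
    Real.toNNReal |lam0| * ‖u0‖₊, fun φ hφ => ?_⟩
  have hC' : ∀ᵐ t ∂volume.restrict (Icc 0 T), ∀ᵐ x ∂volume.restrict Ω, |arctanMean π t x| ≤ C := by
    rw [Measure.volume_eq_prod, ← Measure.prod_restrict] at hC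
    exact Measure.ae_ae_of_ae_prod hC
  refine enorm_sub_le.trans ?_
  refine (add_le_add (enorm_integral_le_lintegral_enorm _)
    (enorm_integral_le_lintegral_enorm _)).trans ?_
  have h1 : ∀ᵐ t ∂volume.restrict (Icc 0 T), ‖∫ x in Ω,
      (ν * arctanMean π t x * ‖(u t).grad x‖ + μ * (u t).lap x) * (φ t).lap x‖ₑ ≤
      ENNReal.ofReal (2 * |ν| * |C| + 4 * |μ|) * ‖u t‖ₑ * ‖φ t‖ₑ := by
    filter_upwards [hC'] with t ht using enorm_integral_diffusion_le ν μ ht _ _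
  have h2 : ∀ t, ‖∫ x in Ω, fidelity Ω D lam0 x * (u0 x - (u t).fn x) * (φ t).fn x‖ₑ ≤
      ENNReal.ofReal |lam0| * (‖u0‖ₑ + ‖u t‖ₑ) * ‖φ t‖ₑ := by
    intro t
    refine (enorm_integral_fidelity_le lam0 u0 _ _).trans ?_
    have e1 : ‖(u t).fn‖ₑ ≤ ‖u t‖ₑ := enorm_le_iff_norm_le.2 (u t).norm_fn_le
    have e2 : ‖(φ t).fn‖ₑ ≤ ‖φ t‖ₑ := enorm_le_iff_norm_le.2 (φ t).norm_fn_le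
    gcongr
  refine (add_le_add (lintegral_mono_ae h1) (lintegral_mono h2)).trans (le_of_eq ?_)
  have hm : AEMeasurable (fun t => ENNReal.ofReal (2 * |ν| * |C| + 4 * |μ|) * ‖u t‖ₑ * ‖φ t‖ₑ)
      (volume.restrict (Icc 0 T)) := (hu.memL2H2.1.enorm.const_mul _).mul hφ.enorm
  rw [← lintegral_add_left' hm]
  refine lintegral_congr fun t => ?_
  push_cast
  simp only [ENNReal.ofReal, ← enorm_eq_nnnorm]
  ring

/-! ### Integral operators in time with `C¹` kernels -/

/-- A bounded continuous kernel `k` on `ℝ × ℝ` whose partial derivative `k'` in the first variable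
is bounded and continuous. -/
structure IsC1Kernel (k k' : ℝ → ℝ → ℝ) : Prop where
  hasDerivAt : ∀ s t, HasDerivAt (fun s => k s t) (k' s t) s
  continuous : Continuous fun p : ℝ × ℝ => k p.1 p.2
  continuous' : Continuous fun p : ℝ × ℝ => k' p.1 p.2
  bounded : ∃ M, ∀ s t, ‖k s t‖ ≤ M
  bounded' : ∃ M, ∀ s t, ‖k' s t‖ ≤ M

lemma IsC1Kernel.sub {k k' l l' : ℝ → ℝ → ℝ} (hk : IsC1Kernel k k') (hl : IsC1Kernel l l') :
    IsC1Kernel (fun s t => k s t - l s t) (fun s t => k' s t - l' s t) where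
  hasDerivAt s t := (hk.hasDerivAt s t).sub (hl.hasDerivAt s t)
  continuous := hk.continuous.sub hl.continuous
  continuous' := hk.continuous'.sub hl.continuous'
  bounded := by
    obtain ⟨M, hM⟩ := hk.bounded
    obtain ⟨N, hN⟩ := hl.bounded
    exact ⟨M + N, fun s t => norm_sub_le_of_le (hM s t) (hN s t)⟩
  bounded' := by
    obtain ⟨M, hM⟩ := hk.bounded'
    obtain ⟨N, hN⟩ := hl.bounded'
    exact ⟨M + N, fun s t => norm_sub_le_of_le (hM s t) (hN s t)⟩

lemma IsC1Kernel.comp_affine {r : ℝ → ℝ} (hr : ContDiff ℝ ∞ r) (hc : HasCompactSupport r)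
    (a b c : ℝ) :
    IsC1Kernel (fun s t => r (a * s + b * t + c)) (fun s t => a * deriv r (a * s + b * t + c)) where
  hasDerivAt s t := by
    have h1 : HasDerivAt (fun s => a * s + b * t + c) a s := by
      simpa using (((hasDerivAt_id s).const_mul a).add_const (b * t)).add_const c
    have h2 := ((hr.differentiable (by simp)) (a * s + b * t + c)).hasDerivAt.comp s h1
    exact h2.congr_deriv (mul_comm _ _)
  continuous := hr.continuous.comp (by fun_prop)
  continuous' := continuous_const.mul ((hr.continuous_deriv (by simp)).comp (by fun_prop))
  bounded := by
    obtain ⟨M, hM⟩ := hc.exists_bound_of_continuous hr.continuous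
    exact ⟨M, fun s t => hM _⟩
  bounded' := by
    obtain ⟨M, hM⟩ := hc.deriv.exists_bound_of_continuous (hr.continuous_deriv (by simp))
    refine ⟨|a| * M, fun s t => ?_⟩
    rw [norm_mul, Real.norm_eq_abs a]
    gcongr
    exact hM _

section Kernel

variable {k k' : ℝ → ℝ → ℝ} {E : Type*} [NormedAddCommGroup E]

lemma IsC1Kernel.integrable_smul [NormedSpace ℝ E] (hk : IsC1Kernel k k') {m : Measure ℝ}
    {f : ℝ → E} (hf : Integrable f m) (s : ℝ) : Integrable (fun t => k s t • f t) m := by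
  obtain ⟨M, hM⟩ := hk.bounded
  exact hf.bdd_smul M
    (hk.continuous.comp (Continuous.prodMk_right s)).aestronglyMeasurable
    (Filter.Eventually.of_forall (hM s))

lemma IsC1Kernel.integrable_smul' [NormedSpace ℝ E] (hk : IsC1Kernel k k') {m : Measure ℝ}
    {f : ℝ → E} (hf : Integrable f m) (s : ℝ) : Integrable (fun t => k' s t • f t) m := by
  obtain ⟨M, hM⟩ := hk.bounded'
  exact hf.bdd_smul M
    (hk.continuous'.comp (Continuous.prodMk_right s)).aestronglyMeasurable
    (Filter.Eventually.of_forall (hM s))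

lemma IsC1Kernel.integrable_smul_left' [NormedSpace ℝ E] (hk : IsC1Kernel k k') {m : Measure ℝ}
    {f : ℝ → E} (hf : Integrable f m) (t : ℝ) : Integrable (fun s => k' s t • f s) m := by
  obtain ⟨M, hM⟩ := hk.bounded'
  exact hf.bdd_smul M
    (hk.continuous'.comp (Continuous.prodMk_left t)).aestronglyMeasurable
    (Filter.Eventually.of_forall fun s => hM s t)

lemma IsC1Kernel.hasDerivAt_integral [NormedSpace ℝ E] (hk : IsC1Kernel k k')
    {m : Measure ℝ} {f : ℝ → E} (hf : Integrable f m) (s : ℝ) :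
    HasDerivAt (fun s => ∫ t, k s t • f t ∂m) (∫ t, k' s t • f t ∂m) s := by
  obtain ⟨M, hM⟩ := hk.bounded'
  refine (hasDerivAt_integral_of_dominated_loc_of_deriv_le (F := fun s t => k s t • f t)
    (F' := fun s t => k' s t • f t)
    (bound := fun t => M * ‖f t‖) (s := univ)
    Filter.univ_mem
    (Filter.Eventually.of_forall fun s => (hk.integrable_smul hf s).1)
    (hk.integrable_smul hf s) (hk.integrable_smul' hf s).1 ?_ (hf.norm.const_mul M) ?_).2
  · refine Filter.Eventually.of_forall fun t s _ => ?_
    rw [norm_smul]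
    gcongr
    exact hM s t
  · exact Filter.Eventually.of_forall fun t s _ => (hk.hasDerivAt s t).smul_const (f t)

lemma IsC1Kernel.exists_lipschitz_integral [NormedSpace ℝ E] (hk : IsC1Kernel k k')
    {m : Measure ℝ} {f : ℝ → E} (hf : Integrable f m) :
    ∃ K, LipschitzWith K fun s => ∫ t, k s t • f t ∂m := by
  obtain ⟨M, hM⟩ := hk.bounded'
  refine ⟨Real.toNNReal (∫ t, M * ‖f t‖ ∂m), lipschitzWith_of_nnnorm_deriv_le
    (fun s => (hk.hasDerivAt_integral hf s).differentiableAt) fun s => ?_⟩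
  rw [(hk.hasDerivAt_integral hf s).deriv]
  refine NNReal.coe_le_coe.1 (le_trans ?_ (Real.le_coe_toNNReal _))
  refine norm_integral_le_of_norm_le (hf.norm.const_mul M) (Filter.Eventually.of_forall fun t => ?_)
  rw [norm_smul]
  gcongr
  exact hM s t

variable [InnerProductSpace ℝ E]

lemma IsC1Kernel.integrable_prod_inner (hk : IsC1Kernel k k') {m n : Measure ℝ} [SFinite m]
    [SFinite n] {f g : ℝ → E} (hf : Integrable f m) (hg : Integrable g n) :
    Integrable (fun p : ℝ × ℝ => k' p.1 p.2 * inner ℝ (f p.1) (g p.2)) (m.prod n) := by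
  obtain ⟨M, hM⟩ := hk.bounded'
  have h : Integrable (fun p : ℝ × ℝ => (inner ℝ (f p.1) (g p.2) : ℝ)) (m.prod n) :=
    hf.op_fst_snd (op := fun x y : E => (inner ℝ x y : ℝ)) continuous_inner
      ⟨1, fun x y => by simpa using norm_inner_le_norm (𝕜 := ℝ) x y⟩ hg
  exact h.bdd_mul (c := M) hk.continuous'.aestronglyMeasurable
    (Filter.Eventually.of_forall fun p => hM p.1 p.2)

/-- Both sides are iterated integrals of `k'(s,t) ⟨f s, g t⟩`, which is integrable on the product
since `k'` is bounded. This moves the kernel from the test function to the solution. -/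
lemma IsC1Kernel.integral_inner_swap [CompleteSpace E] (hk : IsC1Kernel k k') {m n : Measure ℝ}
    [SFinite m] [SFinite n] {f g : ℝ → E} (hf : Integrable f m) (hg : Integrable g n) :
    Integrable (fun t => inner ℝ (∫ s, k' s t • f s ∂m) (g t)) n ∧
    ∫ t, inner ℝ (∫ s, k' s t • f s ∂m) (g t) ∂n =
      ∫ s, inner ℝ (f s) (∫ t, k' s t • g t ∂n) ∂m := by
  have e1 : ∀ t, inner ℝ (∫ s, k' s t • f s ∂m) (g t) =
      ∫ s, k' s t * inner ℝ (f s) (g t) ∂m := by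
    intro t
    rw [real_inner_comm, ← integral_inner (hk.integrable_smul_left' hf t)]
    simp only [inner_smul_right, real_inner_comm]
  have e2 : ∀ s, inner ℝ (f s) (∫ t, k' s t • g t ∂n) =
      ∫ t, k' s t * inner ℝ (f s) (g t) ∂n := by
    intro s
    rw [← integral_inner (hk.integrable_smul' hg s)]
    simp only [inner_smul_right]
  simp only [e1, e2]
  have h := hk.integrable_prod_inner hf hg
  exact ⟨h.integral_prod_right, (integral_integral_swap h).symm⟩

end Kernel

/-! ### Schur's test and its use for vector-valued smoothing -/

/-- **Schur's test** for a nonnegative kernel with row and column integrals at most `c`. -/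
lemma lintegral_schur_le {α β : Type*} [MeasurableSpace α] [MeasurableSpace β] {m : Measure α}
    {n : Measure β} [SFinite m] [SFinite n] {K : α → β → ENNReal}
    (hK : Measurable (Function.uncurry K)) {c : ENNReal}
    (h1 : ∀ x, ∫⁻ y, K x y ∂n ≤ c) (h2 : ∀ y, ∫⁻ x, K x y ∂m ≤ c)
    {f : α → ENNReal} {g : β → ENNReal} (hf : AEMeasurable f m) (hg : AEMeasurable g n) :
    ∫⁻ x, f x * ∫⁻ y, K x y * g y ∂n ∂m ≤
      c * ((∫⁻ x, f x ^ (2 : ℝ) ∂m) ^ (1 / 2 : ℝ) * (∫⁻ y, g y ^ (2 : ℝ) ∂n) ^ (1 / 2 : ℝ)) := by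
  have hKx : ∀ x, Measurable (K x) := fun x => hK.of_uncurry_left
  have hKy : ∀ y, Measurable fun x => K x y := fun y => hK.of_uncurry_right
  have hf' : AEMeasurable (fun p : α × β => f p.1) (m.prod n) :=
    hf.comp_quasiMeasurePreserving Measure.quasiMeasurePreserving_fst
  have hg' : AEMeasurable (fun p : α × β => g p.2) (m.prod n) :=
    hg.comp_quasiMeasurePreserving Measure.quasiMeasurePreserving_snd
  have hK2 : Measurable fun p : α × β => K p.1 p.2 ^ (1 / 2 : ℝ) := hK.pow_const _
  have hs : ∀ a : ENNReal, a ^ (1 / 2 : ℝ) * a ^ (1 / 2 : ℝ) = a := by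
    intro a
    rw [← ENNReal.rpow_add_of_nonneg _ _ (by norm_num) (by norm_num)]
    norm_num
  have hs' : ∀ a : ENNReal, (a ^ (1 / 2 : ℝ)) ^ (2 : ℝ) = a := by
    intro a
    rw [← ENNReal.rpow_mul]
    norm_num
  have hfK : AEMeasurable (fun p : α × β => f p.1 * K p.1 p.2 ^ (1 / 2 : ℝ)) (m.prod n) :=
    hf'.mul hK2.aemeasurable
  have hgK : AEMeasurable (fun p : α × β => g p.2 * K p.1 p.2 ^ (1 / 2 : ℝ)) (m.prod n) :=
    hg'.mul hK2.aemeasurable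
  -- Split `K = K^{1/2} K^{1/2}`, one root for each of `f` and `g`, to prepare Cauchy–Schwarz on the
  -- product space.
  have e : ∫⁻ x, f x * ∫⁻ y, K x y * g y ∂n ∂m =
      ∫⁻ p : α × β, ((fun p : α × β => f p.1 * K p.1 p.2 ^ (1 / 2 : ℝ)) *
        fun p : α × β => g p.2 * K p.1 p.2 ^ (1 / 2 : ℝ)) p ∂(m.prod n) := by
    rw [lintegral_prod _ (hfK.mul hgK)]
    refine lintegral_congr fun x => ?_
    have hKg : AEMeasurable (fun y => K x y * g y) n := (hKx x).aemeasurable.mul hg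
    rw [← lintegral_const_mul'' _ hKg]
    refine lintegral_congr fun y => ?_
    simp only [Pi.mul_apply]
    conv_lhs => rw [← hs (K x y)]
    ring
  rw [e]
  refine (ENNReal.lintegral_mul_le_Lp_mul_Lq (m.prod n) Real.HolderConjugate.two_two
    hfK hgK).trans ?_
  have hF : ∫⁻ p : α × β, (f p.1 * K p.1 p.2 ^ (1 / 2 : ℝ)) ^ (2 : ℝ) ∂(m.prod n) ≤
      c * ∫⁻ x, f x ^ (2 : ℝ) ∂m := by
    rw [lintegral_prod _ (hfK.pow_const _),
      ← lintegral_const_mul'' _ (hf.pow_const _)]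
    refine lintegral_mono fun x => ?_
    simp only [ENNReal.mul_rpow_of_nonneg _ _ (zero_le_two : (0 : ℝ) ≤ 2), hs']
    rw [lintegral_const_mul _ (hKx x), mul_comm]
    gcongr
    exact h1 x
  have hG : ∫⁻ p : α × β, (g p.2 * K p.1 p.2 ^ (1 / 2 : ℝ)) ^ (2 : ℝ) ∂(m.prod n) ≤
      c * ∫⁻ y, g y ^ (2 : ℝ) ∂n := by
    rw [lintegral_prod_symm _ (hgK.pow_const _),
      ← lintegral_const_mul'' _ (hg.pow_const _)]
    refine lintegral_mono fun y => ?_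
    simp only [ENNReal.mul_rpow_of_nonneg _ _ (zero_le_two : (0 : ℝ) ≤ 2), hs']
    rw [lintegral_const_mul _ (hKy y), mul_comm]
    gcongr
    exact h2 y
  refine (mul_le_mul' (ENNReal.rpow_le_rpow hF (by norm_num))
    (ENNReal.rpow_le_rpow hG (by norm_num))).trans (le_of_eq ?_)
  rw [ENNReal.mul_rpow_of_nonneg _ _ (by norm_num), ENNReal.mul_rpow_of_nonneg _ _ (by norm_num),
    mul_mul_mul_comm, hs]

lemma IsC1Kernel.aestronglyMeasurable_integral {k k' : ℝ → ℝ → ℝ} (hk : IsC1Kernel k k')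
    {E : Type*} [NormedAddCommGroup E] [NormedSpace ℝ E] {m n : Measure ℝ} {f : ℝ → E}
    (hf : Integrable f n) : AEStronglyMeasurable (fun s => ∫ t, k s t • f t ∂n) m := by
  obtain ⟨K, hK⟩ := hk.exists_lipschitz_integral hf
  exact hK.continuous.aestronglyMeasurable

/-- Only the masses of `|k|` enter, not the size of `k'`; this makes the final bound uniform in the
scale. -/
lemma IsC1Kernel.lintegral_mul_enorm_integral_le {k k' : ℝ → ℝ → ℝ} (hk : IsC1Kernel k k')
    {E : Type*} [NormedAddCommGroup E] [NormedSpace ℝ E] {m n : Measure ℝ} [SFinite m] [SFinite n]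
    {c : ENNReal} (h1 : ∀ s, ∫⁻ t, ‖k s t‖ₑ ∂n ≤ c) (h2 : ∀ t, ∫⁻ s, ‖k s t‖ₑ ∂m ≤ c)
    {g : ℝ → ℝ} (hg : AEStronglyMeasurable g m) {f : ℝ → E} (hf : AEStronglyMeasurable f n) :
    ∫⁻ s, ‖g s‖ₑ * ‖∫ t, k s t • f t ∂n‖ₑ ∂m ≤ c * (eLpNorm g 2 m * eLpNorm f 2 n) := by
  have hn : ∀ s, ‖∫ t, k s t • f t ∂n‖ₑ ≤ ∫⁻ t, ‖k s t‖ₑ * ‖f t‖ₑ ∂n := by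
    intro s
    refine (enorm_integral_le_lintegral_enorm _).trans (le_of_eq ?_)
    simp only [enorm_smul]
  refine (lintegral_mono fun s => mul_le_mul_right (hn s) _).trans ?_
  refine (lintegral_schur_le (K := fun s t => ‖k s t‖ₑ) hk.continuous.enorm.measurable h1 h2
    hg.enorm hf.enorm).trans (le_of_eq ?_)
  rw [eLpNorm_eq_lintegral_rpow_enorm_toReal (by simp) (by simp),
    eLpNorm_eq_lintegral_rpow_enorm_toReal (by simp) (by simp)]
  simp only [ENNReal.toReal_ofNat]

/-! ### Smoothed test functions and the duality bound -/

/-- The Bochner integral of a function with values in a closed subspace of a Hilbert space lies in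
this subspace. -/
lemma integral_mem_of_isClosed {α E : Type*} [MeasurableSpace α] {m : Measure α}
    [NormedAddCommGroup E] [InnerProductSpace ℝ E] [CompleteSpace E] {S : Submodule ℝ E}
    (hS : IsClosed (S : Set E)) {f : α → E} (hf : Integrable f m) (h : ∀ᵐ x ∂m, f x ∈ S) :
    ∫ x, f x ∂m ∈ S := by
  have : CompleteSpace S := hS.completeSpace_coe
  -- The orthogonal projection onto `S` commutes with the integral and fixes almost every value.
  have e : S.starProjection (∫ x, f x ∂m) = ∫ x, f x ∂m := by
    rw [← ContinuousLinearMap.integral_comp_comm _ hf]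
    refine integral_congr_ae ?_
    filter_upwards [h] with x hx using Submodule.starProjection_eq_self_iff.2 hx
  exact Submodule.starProjection_eq_self_iff.1 e

lemma H2.fn_integral {Ω : Set Plane} {α : Type*} [MeasurableSpace α] {m : Measure α}
    {f : α → H2 Ω} (hf : Integrable f m) : (∫ t, f t ∂m).fn = ∫ t, (f t).fn ∂m :=
  ((H2.fnL Ω).integral_comp_comm hf).symm

lemma MemL2H2.integrableOn {Ω : Set Plane} {T : ℝ} {u : ℝ → H2 Ω} (hu : MemL2H2 Ω T u) :
    IntegrableOn u (Icc 0 T) :=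
  MemLp.integrable one_le_two hu

lemma integrableOn_fn {Ω : Set Plane} {s : Set ℝ} {u : ℝ → H2 Ω} (hu : IntegrableOn u s) :
    IntegrableOn (fun t => (u t).fn) s :=
  (H2.fnL Ω).integrable_comp hu

/-- The smoothing of a function in `W₂` by a `C¹` kernel vanishing at the end points is an
admissible test function of the weak formulation. -/
lemma IsC1Kernel.isSolTest {Ω : Set Plane} {T : ℝ} {k k' : ℝ → ℝ → ℝ} (hk : IsC1Kernel k k')
    {I : Set ℝ} (hIT : I ⊆ Icc 0 T) (hI : MeasurableSet I) (hkT : ∀ t ∈ I, k T t = 0)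
    {φ : ℝ → H2 Ω} (hφ : MemW2 Ω T φ) : IsSolTest Ω T fun s => ∫ t in I, k s t • φ t := by
  have hint : IntegrableOn φ I := hφ.1.integrableOn.mono_set hIT
  refine ⟨?_, fun s _ => ?_, ?_⟩
  · obtain ⟨K, hK⟩ := hk.exists_lipschitz_integral hint
    exact ⟨K, hK.lipschitzOnWith⟩
  · refine integral_mem_of_isClosed (isClosed_H20Submodule Ω) (hk.integrable_smul hint s) ?_
    filter_upwards [ae_restrict_of_ae_restrict_of_subset hIT hφ.2] with t ht
    -- `H20Submodule` has by definition the same underlying set as `H20`.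
    exact (H20Submodule Ω).smul_mem _ ht
  · refine (setIntegral_congr_fun (g := fun _ => (0 : H2 Ω)) hI fun t ht => ?_).trans (by simp)
    simp [hkT t ht]

/-- The time derivative of a solution, tested against functions in `W₂` smoothed by a `C¹` kernel
which vanishes at the end points, is bounded uniformly in the kernel. -/
lemma IsYoungSolution.exists_kernel_bound {Ω D : Set Plane} {T ν μ lam0 : ℝ}
    {u0 : L2 Ω} {u : ℝ → H2 Ω} {π : ℝ → Plane → SignedMeasure ℝ}
    (hu : IsYoungSolution Ω D T ν μ lam0 u0 u π) :
    ∃ c : ℝ, ∀ k k' : ℝ → ℝ → ℝ, IsC1Kernel k k' → ∀ I ⊆ Icc 0 T, MeasurableSet I →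
      (∀ t ∈ I, k 0 t = 0) → (∀ t ∈ I, k T t = 0) →
      (∀ s, ∫⁻ t, ‖k s t‖ₑ ≤ 3) → (∀ t, ∫⁻ s, ‖k s t‖ₑ ≤ 3) → ∀ φ : ℝ → H2 Ω, MemW2 Ω T φ →
      |∫ s in Icc 0 T, inner ℝ (u s).fn (∫ t in I, k' s t • (φ t).fn)| ≤
        c * normL2H2 Ω T φ := by
  obtain ⟨A, B, hAB⟩ := hu.exists_enorm_rhs_le
  have hG : MemLp (fun s => (A : ℝ) * ‖u s‖ + B) 2 (volume.restrict (Icc 0 T)) :=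
    (hu.memL2H2.norm.const_mul _).add (memLp_const _)
  -- The 3 is the bound on the kernel masses; the norm depends on the solution only.
  refine ⟨3 * (eLpNorm (fun s => (A : ℝ) * ‖u s‖ + B) 2 (volume.restrict (Icc 0 T))).toReal, ?_⟩
  intro k k' hk I hIT hI hk0 hkT hk1 hk2 φ hφ
  have hint : IntegrableOn φ I := hφ.1.integrableOn.mono_set hIT
  set ψ : ℝ → H2 Ω := fun s => ∫ t in I, k s t • φ t
  have hψ0 : ψ 0 = 0 := by
    refine (setIntegral_congr_fun (g := fun _ => (0 : H2 Ω)) hI fun t ht => ?_).trans (by simp)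
    simp [hk0 t ht]
  have hψd : ∀ s, (deriv ψ s).fn = ∫ t in I, k' s t • (φ t).fn := by
    intro s
    rw [(hk.hasDerivAt_integral hint s).deriv, H2.fn_integral (hk.integrable_smul' hint s)]
    rfl
  have hw := hu.weak_form ψ (hk.isSolTest hIT hI hkT hφ)
  have h0 : ∫ x in Ω, u0 x * (ψ 0).fn x = 0 := by
    rw [hψ0, ← inner_eq_integral]
    exact inner_zero_right u0
  have h1 : ∫ s in Icc 0 T, inner ℝ (u s).fn (∫ t in I, k' s t • (φ t).fn) =
      ∫ s in Icc 0 T, ∫ x in Ω, (u s).fn x * (deriv ψ s).fn x := by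
    simp only [inner_eq_integral, hψd]
  rw [h0, add_zero] at hw
  have hb := hAB ψ (hk.aestronglyMeasurable_integral hint)
  rw [← hw, ← h1] at hb
  have hφI : AEStronglyMeasurable φ (volume.restrict I) := hint.1
  have hGe : ∀ s, (A : ENNReal) * ‖u s‖ₑ + B = ‖(A : ℝ) * ‖u s‖ + B‖ₑ := by
    intro s
    rw [Real.enorm_eq_ofReal (by positivity), ENNReal.ofReal_add (by positivity) (by positivity),
      ENNReal.ofReal_mul (by positivity), ofReal_norm]
    simp
  have hS := hk.lintegral_mul_enorm_integral_le (m := volume.restrict (Icc 0 T))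
    (n := volume.restrict I) (c := 3)
    (fun s => (setLIntegral_le_lintegral _ _).trans (hk1 s))
    (fun t => (setLIntegral_le_lintegral _ _).trans (hk2 t)) hG.1 hφI
  have hm : eLpNorm φ 2 (volume.restrict I) ≤ eLpNorm φ 2 (volume.restrict (Icc 0 T)) :=
    eLpNorm_mono_measure φ (Measure.restrict_mono_set volume hIT)
  have hfin := calc
    ‖∫ s in Icc 0 T, inner ℝ (u s).fn (∫ t in I, k' s t • (φ t).fn)‖ₑ
      ≤ _ := hb
    _ = ∫⁻ s in Icc 0 T, ‖(A : ℝ) * ‖u s‖ + B‖ₑ * ‖ψ s‖ₑ := by simp only [hGe]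
    _ ≤ _ := hS
    _ ≤ 3 * (eLpNorm (fun s => (A : ℝ) * ‖u s‖ + B) 2 (volume.restrict (Icc 0 T)) *
          eLpNorm φ 2 (volume.restrict (Icc 0 T))) :=
        mul_le_mul_right (mul_le_mul_right hm _) _
  have hne := ENNReal.mul_ne_top (by simp : (3 : ENNReal) ≠ ⊤)
    (ENNReal.mul_ne_top hG.2.ne hφ.1.2.ne)
  have hr := ENNReal.toReal_mono hne hfin
  rw [toReal_enorm, ENNReal.toReal_mul, ENNReal.toReal_mul, ← mul_assoc] at hr
  simpa [normL2H2] using hr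

/-- Fubini turns the duality bound into the claim, provided `∂ₜv` has the kernel `-∂ₛk`; this is
needed only for `t ∈ I`. -/
lemma timeDerivBounded_of_kernel {Ω : Set Plane} {T c : ℝ} {u : ℝ → H2 Ω} (hu : MemL2H2 Ω T u)
    {k k' : ℝ → ℝ → ℝ} (hk : IsC1Kernel k k') {I : Set ℝ} (hIT : I ⊆ Icc 0 T)
    (hI : MeasurableSet I)
    (hc : ∀ φ : ℝ → H2 Ω, MemW2 Ω T φ →
      |∫ s in Icc 0 T, inner ℝ (u s).fn (∫ t in I, k' s t • (φ t).fn)| ≤ c * normL2H2 Ω T φ)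
    {v v' : ℝ → L2 Ω} (hv : ∀ t, HasDerivAt v (v' t) t)
    (hv' : ∀ t ∈ I, v' t = -∫ s in Icc 0 T, k' s t • (u s).fn) :
    TimeDerivBounded Ω T I v c := by
  refine ⟨fun t => (hv t).differentiableAt, fun φ hφ => ?_⟩
  obtain ⟨h1, h2⟩ := hk.integral_inner_swap (integrableOn_fn hu.integrableOn)
    (integrableOn_fn (hφ.1.integrableOn.mono_set hIT))
  have e : ∀ t ∈ I, -inner ℝ (∫ s in Icc 0 T, k' s t • (u s).fn) (φ t).fn =
      ∫ x in Ω, deriv v t x * (φ t).fn x := by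
    intro t ht
    rw [← inner_eq_integral, (hv t).deriv, hv' t ht, inner_neg_left]
  refine ⟨IntegrableOn.congr_fun h1.neg e hI, ?_⟩
  rw [← setIntegral_congr_fun hI e, integral_neg, abs_neg, h2]
  exact hc φ hφ

/-! ### The rescaled mollifier and its kernels -/

/-- The rescaled kernel `ε⁻¹ ρ(·/ε)`. -/
noncomputable def rescale (ρ : ℝ → ℝ) (ε s : ℝ) : ℝ := ε⁻¹ * ρ (s / ε)

section Rescale

variable {ρ : ℝ → ℝ} {ε : ℝ}

lemma IsMollifier.contDiff_rescale (hρ : IsMollifier ρ) : ContDiff ℝ ∞ (rescale ρ ε) :=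
  contDiff_const.mul (hρ.smooth.comp (contDiff_id.div_const ε))

lemma IsMollifier.hasCompactSupport_rescale (hρ : IsMollifier ρ) (hε : 0 < ε) :
    HasCompactSupport (rescale ρ ε) := by
  have h := hρ.compactSupport.comp_smul (inv_ne_zero hε.ne')
  have e : rescale ρ ε = fun s => ε⁻¹ * ρ (ε⁻¹ • s) := by
    ext s
    rw [rescale, smul_eq_mul, div_eq_inv_mul]
  rw [e]
  exact h.mul_left (f := fun _ => ε⁻¹)

lemma IsMollifier.lintegral_rescale (hρ : IsMollifier ρ) (hε : 0 < ε) :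
    ∫⁻ s, ‖rescale ρ ε s‖ₑ = 1 := by
  have hi : Integrable (rescale ρ ε) :=
    hρ.contDiff_rescale.continuous.integrable_of_hasCompactSupport
      (hρ.hasCompactSupport_rescale hε)
  have h0 : ∀ s, 0 ≤ rescale ρ ε s := fun s => mul_nonneg (by positivity) (hρ.nonneg _)
  simp only [Real.enorm_eq_ofReal (h0 _)]
  rw [← ofReal_integral_eq_lintegral_ofReal hi (Filter.Eventually.of_forall h0)]
  simp only [rescale]
  rw [integral_const_mul, Measure.integral_comp_div, hρ.integral_eq_one, abs_of_pos hε]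
  simp [hε.ne']

/-- The zero set is closed, so vanishing extends to the end point `a`, which is exactly where the
boundary conditions on the kernel are checked. -/
lemma rescale_eq_zero_of_le {a s : ℝ} (hr : Continuous (rescale ρ ε))
    (h : ∀ x > a, rescale ρ ε x = 0) (hs : a ≤ s) : rescale ρ ε s = 0 := by
  have : closure (Ioi a) ⊆ {x | rescale ρ ε x = 0} :=
    closure_minimal h (isClosed_eq hr continuous_const)
  rw [closure_Ioi] at this
  exact this hs

lemma rescale_eq_zero_of_ge {a s : ℝ} (hr : Continuous (rescale ρ ε))
    (h : ∀ x < a, rescale ρ ε x = 0) (hs : s ≤ a) : rescale ρ ε s = 0 := by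
  have : closure (Iio a) ⊆ {x | rescale ρ ε x = 0} :=
    closure_minimal h (isClosed_eq hr continuous_const)
  rw [closure_Iio] at this
  exact this hs

lemma IsMollifier.isC1Kernel_sub (hρ : IsMollifier ρ) (hε : 0 < ε) (c : ℝ) :
    IsC1Kernel (fun s t => rescale ρ ε (t - s - c))
    (fun s t => -deriv (rescale ρ ε) (t - s - c)) := by
  convert IsC1Kernel.comp_affine hρ.contDiff_rescale (hρ.hasCompactSupport_rescale hε) (-1) 1 (-c)
    using 3 with s t s t
  · congr 1
    ring
  · rw [neg_one_mul]
    congr 2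
    ring

lemma IsMollifier.isC1Kernel_add (hρ : IsMollifier ρ) (hε : 0 < ε) (c : ℝ) :
    IsC1Kernel (fun s t => rescale ρ ε (t + s - c))
    (fun s t => deriv (rescale ρ ε) (t + s - c)) := by
  convert IsC1Kernel.comp_affine hρ.contDiff_rescale (hρ.hasCompactSupport_rescale hε) 1 1 (-c)
    using 3 with s t s t
  · congr 1
    ring
  · rw [one_mul]
    congr 1
    ring

lemma IsMollifier.isC1Kernel_conv (hρ : IsMollifier ρ) (hε : 0 < ε) :
    IsC1Kernel (fun s t => rescale ρ ε (s - t))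
    (fun s t => deriv (rescale ρ ε) (s - t)) := by
  convert IsC1Kernel.comp_affine hρ.contDiff_rescale (hρ.hasCompactSupport_rescale hε) 1 (-1) 0
    using 3 with s t s t
  · congr 1
    ring
  · rw [one_mul]
    congr 1
    ring

lemma IsMollifier.hasDerivAt_timeMollify (hρ : IsMollifier ρ) (hε : 0 < ε) {Ω : Set Plane}
    {J : Set ℝ} {u : ℝ → H2 Ω}
    (hu : IntegrableOn u J) (t : ℝ) :
    HasDerivAt (timeMollify ρ ε J u) (∫ τ in J, deriv (rescale ρ ε) (t - τ) • (u τ).fn) t :=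
  (hρ.isC1Kernel_conv hε).hasDerivAt_integral (integrableOn_fn hu) t

end Rescale

/-- Supplies the measurability of `I_ε`. -/
lemma isClosed_mollifyDomain {ρ : ℝ → ℝ} (hρ : Continuous ρ) (ε T : ℝ) :
    IsClosed (mollifyDomain ρ ε T) := by
  have e : mollifyDomain ρ ε T =
      Icc 0 T ∩ ⋂ τ, ⋂ (_ : τ ∉ Icc 0 T), {t | ρ ((t - τ) / ε) = 0} := by
    ext t
    simp only [mollifyDomain, mem_inter_iff, mem_iInter, mem_ofPred_eq, not_imp_comm, ne_eq]
  rw [e]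
  exact isClosed_Icc.inter (isClosed_iInter fun τ => isClosed_iInter fun _ =>
    isClosed_eq (hρ.comp (by fun_prop)) continuous_const)

/-! ### Even reflection and folding -/

section Reflect

variable {Ω : Set Plane} {T : ℝ} {u : ℝ → H2 Ω}

lemma reflect_of_mem {t : ℝ} (ht : t ∈ Icc 0 T) : reflect T u t = u t := by
  rw [reflect, if_neg (not_lt.2 ht.1), if_pos ht.2]

lemma reflect_neg {t : ℝ} (ht : t ∈ Icc 0 T) : reflect T u (-t) = u t := by
  rcases ht.1.eq_or_lt with rfl | h
  · rw [neg_zero, reflect_of_mem ht]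
  · rw [reflect, if_pos (neg_lt_zero.2 h), neg_neg]

lemma reflect_two_mul_sub {t : ℝ} (ht : t ∈ Icc 0 T) : reflect T u (2 * T - t) = u t := by
  rcases ht.2.eq_or_lt with rfl | h
  · rw [two_mul, add_sub_cancel_right, reflect_of_mem ht]
  · rw [reflect, if_neg (by linarith [ht.1]), if_neg (by linarith), sub_sub_cancel]

lemma integrableOn_reflect (hT : 0 < T) (hu : IntegrableOn u (Icc 0 T)) :
    IntegrableOn (reflect T u) (Icc (-T) (2 * T)) := by
  have hu' : IntervalIntegrable u volume 0 T :=
    (intervalIntegrable_iff_integrableOn_Icc_of_le hT.le).2 hu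
  have h1 : IntervalIntegrable (reflect T u) volume (-T) 0 := by
    have h := (hu'.comp_sub_left 0).symm
    rw [zero_sub, sub_zero] at h
    refine h.congr fun t ht => ?_
    rw [uIoc_of_le (by linarith)] at ht
    rw [← reflect_neg (T := T) (u := u) (t := 0 - t) ⟨by linarith [ht.2], by linarith [ht.1]⟩, zero_sub,
      neg_neg]
  have h2 : IntervalIntegrable (reflect T u) volume 0 T := by
    refine hu'.congr fun t ht => ?_
    rw [uIoc_of_le hT.le] at ht
    rw [reflect_of_mem ⟨ht.1.le, ht.2⟩]
  have h3 : IntervalIntegrable (reflect T u) volume T (2 * T) := by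
    have h := (hu'.comp_sub_left (2 * T)).symm
    rw [sub_zero, show 2 * T - T = T by ring] at h
    refine h.congr fun t ht => ?_
    rw [uIoc_of_le (by linarith)] at ht
    rw [← reflect_two_mul_sub (T := T) (u := u) (t := 2 * T - t)
      ⟨by linarith [ht.2], by linarith [ht.1]⟩, sub_sub_cancel]
  exact (intervalIntegrable_iff_integrableOn_Icc_of_le (by linarith)).1 ((h1.trans h2).trans h3)

/-- Folding of an integral over `[-T,2T]` onto `[0,T]`. -/
lemma setIntegral_fold {E : Type*} [NormedAddCommGroup E] [NormedSpace ℝ E] (hT : 0 < T)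
    {F : ℝ → E} (hF : IntegrableOn F (Icc (-T) (2 * T))) :
    ∫ s in Icc (-T) (2 * T), F s = ∫ s in Icc 0 T, (F s + F (-s) + F (2 * T - s)) := by
  have hI : ∀ a b, a ≤ b → -T ≤ a → b ≤ 2 * T → IntervalIntegrable F volume a b :=
    fun a b hab ha hb => (intervalIntegrable_iff_integrableOn_Icc_of_le hab).2
      (hF.mono_set (Icc_subset_Icc ha hb))
  have h1 := hI (-T) 0 (by linarith) le_rfl (by linarith)
  have h2 := hI 0 T hT.le (by linarith) (by linarith)
  have h3 := hI T (2 * T) (by linarith) (by linarith) le_rfl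
  have h1' : IntervalIntegrable (fun s => F (-s)) volume 0 T := by
    have h := (h1.comp_sub_left 0).symm
    simpa using h
  have h3' : IntervalIntegrable (fun s => F (2 * T - s)) volume 0 T := by
    have h := (h3.comp_sub_left (2 * T)).symm
    rwa [sub_self, show 2 * T - T = T by ring] at h
  rw [integral_Icc_eq_integral_Ioc, integral_Icc_eq_integral_Ioc,
    ← intervalIntegral.integral_of_le (by linarith), ← intervalIntegral.integral_of_le hT.le,
    intervalIntegral.integral_add (h2.add h1') h3', intervalIntegral.integral_add h2 h1',
    intervalIntegral.integral_comp_neg, intervalIntegral.integral_comp_sub_left,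
    ← intervalIntegral.integral_add_adjacent_intervals (h1.trans h2) h3,
    ← intervalIntegral.integral_add_adjacent_intervals h1 h2]
  rw [neg_zero, sub_zero, show 2 * T - T = T by ring, add_comm (∫ x in (-T)..0, F x)]

end Reflect

/-! ### The two choices of kernel -/

/-- The mollified time derivatives of a solution are bounded functionals on `W₂`, uniformly in the
mollifier and its scale. -/
lemma IsYoungSolution.exists_timeDerivBounded {Ω D : Set Plane} {T ν μ lam0 : ℝ} {u0 : L2 Ω}
    {u : ℝ → H2 Ω} {π : ℝ → Plane → SignedMeasure ℝ} (hT : 0 < T)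
    (hu : IsYoungSolution Ω D T ν μ lam0 u0 u π) :
    ∃ c : ℝ, ∀ ρ : ℝ → ℝ, IsMollifier ρ → ∀ ε : ℝ, 0 < ε →
      TimeDerivBounded Ω T (mollifyDomain ρ ε T) (timeMollify ρ ε (Icc 0 T) u) c ∧
      ((∀ z, ρ z ≠ 0 → ε * |z| ≤ T) →
        TimeDerivBounded Ω T (Icc 0 T)
          (timeMollify ρ ε (Icc (-T) (2 * T)) (reflect T u)) c) := by
  obtain ⟨c, hc⟩ := hu.exists_kernel_bound
  refine ⟨c, fun ρ hρ ε hε => ?_⟩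
  have hui := hu.memL2H2.integrableOn
  have hr : Continuous (rescale ρ ε) := hρ.contDiff_rescale.continuous
  have hone := hρ.lintegral_rescale hε
  have c1 : ∀ s a : ℝ, ∫⁻ t, ‖rescale ρ ε (t - s - a)‖ₑ = 1 := fun s a => by
    rw [← hone]
    simp only [sub_sub]
    exact lintegral_sub_right_eq_self (fun t => ‖rescale ρ ε t‖ₑ) (s + a)
  have c2 : ∀ t a : ℝ, ∫⁻ s, ‖rescale ρ ε (t - s - a)‖ₑ = 1 := fun t a => by
    rw [← hone]
    simp only [sub_right_comm t _ a]
    exact lintegral_sub_left_eq_self (fun s => ‖rescale ρ ε s‖ₑ) (t - a)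
  have c3 : ∀ s a : ℝ, ∫⁻ t, ‖rescale ρ ε (t + s - a)‖ₑ = 1 := fun s a => by
    rw [← hone]
    simp only [add_sub_assoc]
    exact lintegral_add_right_eq_self (fun t => ‖rescale ρ ε t‖ₑ) (s - a)
  have c4 : ∀ t a : ℝ, ∫⁻ s, ‖rescale ρ ε (t + s - a)‖ₑ = 1 := fun t a => by
    simpa only [add_comm] using c3 t a
  constructor
  · have hk := hρ.isC1Kernel_sub hε 0
    have hI : MeasurableSet (mollifyDomain ρ ε T) :=
      (isClosed_mollifyDomain hρ.smooth.continuous ε T).measurableSet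
    have hIT : mollifyDomain ρ ε T ⊆ Icc 0 T := fun t ht => ht.1
    have hz : ∀ t ∈ mollifyDomain ρ ε T, ∀ τ ∉ Icc 0 T, rescale ρ ε (t - τ) = 0 := by
      intro t ht τ hτ
      have : ρ ((t - τ) / ε) = 0 := by_contra fun h => hτ (ht.2 τ h)
      rw [rescale, this, mul_zero]
    refine timeDerivBounded_of_kernel hu.memL2H2 hk hIT hI
      (hc _ _ hk _ hIT hI (fun t ht => ?_) (fun t ht => ?_) (fun s => ?_) (fun t => ?_))
      (fun t => hρ.hasDerivAt_timeMollify hε hui t) (fun t _ => ?_)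
    -- For `x > t` the time `t - x` is negative, so the kernel vanishes there; continuity gives the
    -- value at `x = t`, that is at `s = 0`.
    · refine rescale_eq_zero_of_le (a := t) hr (fun x hx => ?_) (by linarith)
      have h := hz t ht (t - x) (fun h => by linarith [h.1])
      rwa [sub_sub_cancel] at h
    · refine rescale_eq_zero_of_ge (a := t - T) hr (fun x hx => ?_) (by linarith)
      have h := hz t ht (t - x) (fun h => by linarith [h.2])
      rwa [sub_sub_cancel] at h
    · rw [c1]
      norm_num
    · rw [c2]
      norm_num
    · rw [← integral_neg]
      simp only [neg_smul, neg_neg, sub_zero]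
  · intro hsupp
    -- The `s`-derivative of this kernel is minus the sum of the three translates of `r'` produced
    -- by folding the reflected mollification.
    have hk := ((hρ.isC1Kernel_sub hε 0).sub (hρ.isC1Kernel_add hε 0)).sub
      (hρ.isC1Kernel_add hε (2 * T))
    have hz : ∀ x, T < |x| → rescale ρ ε x = 0 := by
      intro x hx
      have : ρ (x / ε) = 0 := by
        by_contra h
        have h' := hsupp _ h
        rw [abs_div, abs_of_pos hε, mul_div_cancel₀ _ hε.ne'] at h'
        linarith
      rw [rescale, this, mul_zero]
    have hz1 : ∀ x, T ≤ x → rescale ρ ε x = 0 := fun x =>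
      rescale_eq_zero_of_le hr fun y hy => hz y (lt_of_lt_of_le hy (le_abs_self y))
    have hz2 : ∀ x, x ≤ -T → rescale ρ ε x = 0 := fun x =>
      rescale_eq_zero_of_ge hr fun y hy => hz y (lt_of_lt_of_le (by linarith) (neg_le_abs y))
    have hthree : ∀ f g h : ℝ → ℝ, Continuous f → Continuous g → ∫⁻ x, ‖f x‖ₑ = 1 →
        ∫⁻ x, ‖g x‖ₑ = 1 → ∫⁻ x, ‖h x‖ₑ = 1 → ∫⁻ x, ‖f x - g x - h x‖ₑ ≤ 3 := by
      intro f g h hf hg e1 e2 e3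
      calc ∫⁻ x, ‖f x - g x - h x‖ₑ ≤ ∫⁻ x, (‖f x‖ₑ + ‖g x‖ₑ + ‖h x‖ₑ) :=
            lintegral_mono fun x =>
              enorm_sub_le.trans (add_le_add enorm_sub_le le_rfl)
        _ = 3 := by
            have hfg : Measurable fun x => ‖f x‖ₑ + ‖g x‖ₑ := (hf.enorm.add hg.enorm).measurable
            rw [lintegral_add_left hfg,
              lintegral_add_left hf.enorm.measurable, e1, e2, e3]
            norm_num
    refine timeDerivBounded_of_kernel hu.memL2H2 hk subset_rfl measurableSet_Icc
      (hc _ _ hk _ subset_rfl measurableSet_Icc (fun t ht => ?_) (fun t ht => ?_) (fun s => ?_)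
        (fun t => ?_))
      (fun t => hρ.hasDerivAt_timeMollify hε (integrableOn_reflect hT hui) t) (fun t _ => ?_)
    -- At `s = 0` the first two terms cancel and the third has argument at most `-T`.
    · rw [hz2 (t + 0 - 2 * T) (by linarith [ht.2])]
      simp
    -- At `s = T` the first and third terms cancel and the second has argument at least `T`.
    · rw [hz1 (t + T - 0) (by linarith [ht.1]), show t + T - 2 * T = t - T - 0 by ring]
      simp
    · exact hthree _ _ _ (hr.comp (by fun_prop)) (hr.comp (by fun_prop)) (c1 s 0) (c3 s 0)
        (c3 s (2 * T))
    · exact hthree _ _ _ (hr.comp (by fun_prop)) (hr.comp (by fun_prop)) (c2 t 0) (c4 t 0)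
        (c4 t (2 * T))
    · have hF := (hρ.isC1Kernel_conv hε).integrable_smul'
        (integrableOn_fn (integrableOn_reflect hT hui)) t
      rw [setIntegral_fold hT hF, ← integral_neg]
      refine setIntegral_congr_fun measurableSet_Icc fun s hs => ?_
      simp only [reflect_of_mem hs, reflect_neg hs, reflect_two_mul_sub hs, sub_zero, ← neg_smul,
        ← add_smul]
      rw [sub_neg_eq_add, show t - (2 * T - s) = t + s - 2 * T by ring]
      congr 1
      ring

end ShockFilter

theorem mainTheorem6 (Ω D : Set ShockFilter.Plane) (hΩ : IsOpen Ω) (hD : MeasurableSet D)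
    (hDΩ : D ⊆ Ω) (T ν μ lam0 : ℝ) (hT : 0 < T) (hν : 0 < ν) (hμ : 0 < μ) (hlam0 : 0 < lam0)
    (u0 : ShockFilter.L2 Ω) (u : ℝ → ShockFilter.H2 Ω)
    (π : ℝ → ShockFilter.Plane → MeasureTheory.SignedMeasure ℝ)
    (hu : ShockFilter.IsYoungSolution Ω D T ν μ lam0 u0 u π) :
    ∃ c : ℝ, ∀ ρ : ℝ → ℝ, ShockFilter.IsMollifier ρ → ∀ ε : ℝ, 0 < ε →
      ShockFilter.TimeDerivBounded Ω T (ShockFilter.mollifyDomain ρ ε T)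
        (ShockFilter.timeMollify ρ ε (Set.Icc 0 T) u) c ∧
      ((∀ z, ρ z ≠ 0 → ε * |z| ≤ T) →
        ShockFilter.TimeDerivBounded Ω T (Set.Icc 0 T)
          (ShockFilter.timeMollify ρ ε (Set.Icc (-T) (2 * T)) (ShockFilter.reflect T u)) c) := by
  exact hu.exists_timeDerivBounded hT
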